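/- Let $V$ be a finite-dimensional real inner product space of dimension $d$ and $E \subseteq V$ a closed set that contains $0$ and has a connected component containing an affine basis of $V$ (that is, $d+1$ affinely independent points). Let $E_\Delta = E \sqcup \{\Delta\}$, where the cemetery $\Delta$ is adjoined as an isolated point, with $\sigma$-algebra $\mathcal E_\Delta = \sigma(\mathcal B(E), \{\Delta\})$. Functions on $E$ are extended to $E_\Delta$ by the value $0$ at $\Delta$. A transition function is a family $\{P_{s,t}\}_{0 \le s \le t}$ of transition probabilities on $(E_\Delta, \mathcal E_\Delta)$ with $P_{s,t}(\Delta, \{\Delta\}) = 1$, $P_{s,s}(x, \cdot) = \delta_x$, and $P_{s,u} P_{u,t} = P_{s,t}$ for $s < u < t$. It is stochastically continuous if for every $x \in E_\Delta$, $P_{s,S}(x, \cdot) \to P_{t,T}(x, \cdot)$ weakly on $E_\Delta$ whenever $(s,S) \to (t,T)$ with $0 \le s \le S$ and $0 \le t \le T$. Let $\langle \cdot, \cdot \rangle$ also denote the bilinear extension $\langle a + \mathrm i b, x \rangle = \langle a, x \rangle + \mathrm i \langle b, x \rangle$ of the inner product. For $u \in V + \mathrm i V$ let $f_u(x) = e^{\langle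 u, x \rangle}$ on $E$ and $f_u(\Delta) = 0$. For $k \in \mathbb N$ put $$\mathcal U_k = \{u \in V + \mathrm i V : \sup_{x \in E} |e^{\langle u, x \rangle}| \le k\}, \qquad \mathcal U = \bigcup_k \mathcal U_k .$$ Let $\{P_{s,t}\}$ be an affine transition function, with functions $\Phi_{s,t} : \mathcal U \to \mathbb C$ and $\psi_{s,t} : \mathcal U \to V + \mathrm i V$ satisfying $$P_{s,t} f_u(x) = \Phi_{s,t}(u)\, e^{\langle \psi_{s,t}(u), x \rangle} \qquad \text{for all } 0 \le s \le t,\ u \in \mathcal U,\ x \in E,$$ and put $$\mathcal Q_k = \{(t,T,u) : 0 \le t \le T,\ u \in \mathcal U_k,\ \Phi_{v,T}(u) \ne 0 \text{ for all } v \in [t,T]\}.$$ Then the following are equivalent. 1. $\{P_{s,t}\}$ is stochastically continuous. 2. For every $k \in \mathbb N$ the map $(t,T,u) \mapsto \psi_{t,T}(u)$ is continuous on $\mathcal Q_k$, and $\psi_{0,0}(0) = 0$; and for every $x \in E$ and $k \in \mathbb N$ the maps $(t,T,u) \mapsto \Phi_{t,T}(u)$ and $(t,T,u) \mapsto P_{t,T}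 f_u(x)$ are continuous on $\{(t,T,u) : 0 \le t \le T,\ u \in \mathcal U_k\}$. -/

import Mathlib

open MeasureTheory ProbabilityTheory Set Topology
open scoped NNReal

namespace AffineProcess

/-- The state space `E` with a cemetery point `Δ` adjoined as an isolated point. Its topology is the
disjoint-union topology, so the continuous functions on it are the continuous functions on `E` with
an arbitrary value at `Δ`; its σ-algebra is the one generated by the Borel sets of `E`
and `{Δ}`. -/
abbrev WithCemetery {V : Type*} (E : Set V) : Type _ := ↥E ⊕ Unit

/-- The cemetery point. -/
abbrev cemetery {V : Type*} (E : Set V) : WithCemetery E := Sum.inr ()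

/-- The σ-algebra `σ(𝓑(E), {Δ})` contains the open sets of `E ∪ {Δ}`. -/
instance instOpensMeasurableSpaceWithCemetery {V : Type*} [TopologicalSpace V] [MeasurableSpace V]
    [BorelSpace V] (E : Set V) : OpensMeasurableSpace (WithCemetery E) where
  borel_le := by
    refine MeasurableSpace.generateFrom_le fun s hs => ?_
    rw [measurableSet_sum_iff]
    have h := isOpen_sum_iff.1 hs
    exact ⟨h.1.measurableSet, MeasurableSet.of_discrete⟩

/-- A (time-inhomogeneous) transition function `{P_{s,t}}_{0 ≤ s ≤ t}` on `E ∪ {Δ}`.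
The values `P s t` for `t < s` are irrelevant: nothing is required of them and nothing uses them. -/
structure TransitionFunction {V : Type*} [MeasurableSpace V] (E : Set V) where
  /-- The kernels. -/
  P : ℝ≥0 → ℝ≥0 → Kernel (WithCemetery E) (WithCemetery E)
  /-- Each `P_{s,t}` is a transition probability. -/
  isProb : ∀ s t, s ≤ t → ∀ x, IsProbabilityMeasure (P s t x)
  /-- The cemetery is absorbing. -/
  absorbing : ∀ s t, s ≤ t → P s t (cemetery E) = Measure.dirac (cemetery E)
  /-- `P_{s,s}(x, ·) = δ_x`. -/
  diag : ∀ s x, P s s x = Measure.dirac x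
  /-- Chapman–Kolmogorov: `P_{s,u} P_{u,t} = P_{s,t}`, where
  `P_{s,u} P_{u,t} (x, A) = ∫ P_{u,t}(y, A) P_{s,u}(x, dy)`. -/
  chapman_kolmogorov : ∀ s u t, s < u → u < t → (P u t) ∘ₖ (P s u) = P s t

/-- The set of pairs of times `0 ≤ s ≤ t`. -/
abbrev TimePair : Type := {p : ℝ≥0 × ℝ≥0 // p.1 ≤ p.2}

section

variable {V : Type*} [NormedAddCommGroup V] [InnerProductSpace ℝ V] [MeasurableSpace V]

/-- The probability measure `P_{s,t}(x, ·)` for `s ≤ t`. -/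
noncomputable def TransitionFunction.law {E : Set V} (P : TransitionFunction E)
    (x : WithCemetery E) (p : TimePair) : ProbabilityMeasure (WithCemetery E) :=
  ⟨P.P p.1.1 p.1.2 x, P.isProb _ _ p.2 x⟩

/-- Stochastic continuity: `P_{s,S}(x, ·) → P_{t,T}(x, ·)` weakly whenever `(s,S) → (t,T)` with
`s ≤ S` and `t ≤ T`. (`ProbabilityMeasure` carries the topology of weak convergence.) -/
def TransitionFunction.StochasticallyContinuous [BorelSpace V] {E : Set V}
    (P : TransitionFunction E) : Prop :=
  ∀ x : WithCemetery E, Continuous (P.law x)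

/-- The complexification `V + iV` of `V`; the pair `(a, b)` stands for `a + i b`. -/
abbrev Cplx (V : Type*) : Type _ := V × V

/-- The bilinear extension `⟨a + i b, x⟩ = ⟨a, x⟩ + i ⟨b, x⟩` of the scalar product. -/
noncomputable def pairing (u : Cplx V) (x : V) : ℂ :=
  (inner ℝ u.1 x : ℂ) + Complex.I * (inner ℝ u.2 x : ℂ)

/-- `f_u(x) = exp ⟨u, x⟩` on `E`, extended by `f_u(Δ) = 0`. -/
noncomputable def expFun (E : Set V) (u : Cplx V) : WithCemetery E → ℂ :=
  Sum.elim (fun x => Complex.exp (pairing u x)) (fun _ => 0)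

/-- `P_{s,t} f_u (x)`. -/
noncomputable def TransitionFunction.expInt {E : Set V} (P : TransitionFunction E)
    (s t : ℝ≥0) (u : Cplx V) (x : E) : ℂ :=
  ∫ y, expFun E u y ∂(P.P s t (Sum.inl x))

/-- `𝒰`: the `u ∈ V + iV` for which `x ↦ exp ⟨u, x⟩` is bounded on `E`. -/
def boundedExponents (E : Set V) : Set (Cplx V) :=
  {u | ∃ C : ℝ, ∀ x ∈ E, ‖Complex.exp (pairing u x)‖ ≤ C}

/-- `𝒰_k`: the `u ∈ V + iV` with `sup_{x ∈ E} |exp ⟨u, x⟩| ≤ k`. -/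
def boundedExponentsBy (E : Set V) (k : ℕ) : Set (Cplx V) :=
  {u | ∀ x ∈ E, ‖Complex.exp (pairing u x)‖ ≤ k}

/-- `{P_{s,t}}` is affine, with `P_{s,t} f_u(x) = Φ_{s,t}(u) exp ⟨ψ_{s,t}(u), x⟩` for `s ≤ t`,
`u ∈ 𝒰` and `x ∈ E`. The values of `Φ` and `ψ` off `𝒰` or for `t < s` are irrelevant. -/
def TransitionFunction.IsAffineWith {E : Set V} (P : TransitionFunction E)
    (Φ : ℝ≥0 → ℝ≥0 → Cplx V → ℂ) (ψ : ℝ≥0 → ℝ≥0 → Cplx V → Cplx V) : Prop :=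
  ∀ s t, s ≤ t → ∀ u ∈ boundedExponents E, ∀ x : E,
    P.expInt s t u x = Φ s t u * Complex.exp (pairing (ψ s t u) x)

/-- `{(t, T, u) : 0 ≤ t ≤ T, u ∈ 𝒰_k}`. -/
def timeExponents (E : Set V) (k : ℕ) : Set (ℝ≥0 × ℝ≥0 × Cplx V) :=
  {q | q.1 ≤ q.2.1 ∧ q.2.2 ∈ boundedExponentsBy E k}

/-- `𝒬_k = {(t, T, u) : 0 ≤ t ≤ T, u ∈ 𝒰_k, Φ_{v,T}(u) ≠ 0 for t ≤ v ≤ T}`. -/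
def nonvanishingDomain (E : Set V) (Φ : ℝ≥0 → ℝ≥0 → Cplx V → ℂ) (k : ℕ) :
    Set (ℝ≥0 × ℝ≥0 × Cplx V) :=
  {q | q ∈ timeExponents E k ∧ ∀ v, q.1 ≤ v → v ≤ q.2.1 → Φ v q.2.1 q.2.2 ≠ 0}

end

end AffineProcess

/-!
If `P_{s,t}(x, ·)` is weakly continuous in `(s, t)`, so is its product with the Dirac mass at `u`.
Against this product the jointly continuous function `(y, u) ↦ f_u(y)`, which is bounded for
`u ∈ 𝒰_k`, integrates to `P_{s,t} f_u(x)`; hence the latter is jointly continuous. Evaluation at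
`x = 0` gives `Φ`. Conversely, the integrals of the `f_u` with `u` purely imaginary determine the
characteristic function after `E ∪ {Δ}` is embedded into `V × ℝ`, so Lévy's continuity theorem
applies.

It remains to see that `exp ⟨w i, x⟩ → exp ⟨w₀, x⟩` on a connected set `C` that spans `V` affinely
forces `w i → w₀`. Only the imaginary part `b i` of `w i - w₀` is delicate: it satisfies
`⟨b i, x⟩ → 0` modulo `2π` on `C`. On a connected set where the cosines of all late `⟨b i, ·⟩` are
at least `1/2`, these functions vary by less than `π`, so that convergence modulo `2π` of their
differences is convergence. Let `W` be the space of `w` with `⟨b i, w⟩ → 0`. The projection of `C`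
to `Wᗮ` is thus a countable union of compact totally disconnected sets. Such a union is totally
disconnected, since two disjoint closed neighbourhoods can be enlarged to cover one compact piece
after another; being connected, the projection is a point, and therefore `W = V`.
-/

open Filter TopologicalSpace

namespace AffineProcess

section TotallyDisconnected

variable {Y : Type*} [TopologicalSpace Y]

lemma exists_isClosed_partition_of_isTotallyDisconnected [T2Space Y] {K A B : Set Y}
    (hK : IsCompact K) (hKd : IsTotallyDisconnected K) (hA : IsClosed A) (hB : IsClosed B)
    (hAB : Disjoint A B) :
    ∃ K₁ K₂, IsClosed K₁ ∧ IsClosed K₂ ∧ Disjoint K₁ K₂ ∧ K₁ ∪ K₂ = K ∧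
      Disjoint K₁ B ∧ Disjoint A K₂ := by
  have := isCompact_iff_compactSpace.1 hK
  have := totallyDisconnectedSpace_subtype_iff.2 hKd
  obtain ⟨S, hS, hAS, hSB⟩ := exists_clopen_of_closed_subset_open
    (hA.preimage (continuous_subtype_val (p := (· ∈ K))))
    (hB.preimage continuous_subtype_val).isOpen_compl (hAB.preimage _).subset_compl_right
  have hemb := hK.isClosed.isClosedEmbedding_subtypeVal
  refine ⟨(↑) '' S, (↑) '' Sᶜ, hemb.isClosedMap _ hS.1, hemb.isClosedMap _ hS.compl.1,
    (disjoint_image_iff Subtype.val_injective).2 disjoint_compl_right, ?_, ?_, ?_⟩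
  · rw [← image_union, union_compl_self, image_univ, Subtype.range_coe]
  · rw [disjoint_left]
    rintro _ ⟨x, hx, rfl⟩ hxB
    exact hSB hx hxB
  · rw [disjoint_right]
    rintro _ ⟨x, hx, rfl⟩ hxA
    exact hx (hAS hxA)

lemma exists_isOpen_covering_of_isTotallyDisconnected [T4Space Y] {K A B : Set Y}
    (hK : IsCompact K) (hKd : IsTotallyDisconnected K) (hA : IsClosed A) (hB : IsClosed B)
    (hAB : Disjoint A B) :
    ∃ U V, IsOpen U ∧ IsOpen V ∧ Disjoint (closure U) (closure V) ∧ A ⊆ U ∧ B ⊆ V ∧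
      K ⊆ U ∪ V := by
  obtain ⟨K₁, K₂, hK₁, hK₂, hK₁₂, rfl, hK₁B, hAK₂⟩ :=
    exists_isClosed_partition_of_isTotallyDisconnected hK hKd hA hB hAB
  have hdisj : Disjoint (A ∪ K₁) (B ∪ K₂) := by
    simp only [disjoint_union_left, disjoint_union_right]
    exact ⟨⟨hAB, hK₁B⟩, hAK₂, hK₁₂⟩
  obtain ⟨U, hU, hAU, hUB⟩ := normal_exists_closure_subset (hA.union hK₁)
    (hB.union hK₂).isOpen_compl hdisj.subset_compl_right
  obtain ⟨V, hV, hBV, hVU⟩ := normal_exists_closure_subset (hB.union hK₂)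
    isClosed_closure.isOpen_compl (subset_compl_comm.1 hUB)
  rw [union_subset_iff] at hAU hBV
  exact ⟨U, V, hU, hV, (subset_compl_iff_disjoint_right.1 hVU).symm, hAU.1, hBV.1,
    union_subset_union hAU.2 hBV.2⟩

lemma isTotallySeparated_iUnion_nat [T4Space Y] {K : ℕ → Set Y} (hK : ∀ n, IsCompact (K n))
    (hKd : ∀ n, IsTotallyDisconnected (K n)) : IsTotallySeparated (⋃ n, K n) := by
  intro x _ y _ hxy
  let Separation := {p : Set Y × Set Y //
    IsOpen p.1 ∧ IsOpen p.2 ∧ Disjoint (closure p.1) (closure p.2)}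
  have hstep : ∀ (n : ℕ) (p : Separation), ∃ q : Separation,
      p.1.1 ⊆ q.1.1 ∧ p.1.2 ⊆ q.1.2 ∧ K n ⊆ q.1.1 ∪ q.1.2 := fun n p => by
    obtain ⟨U, V, hU, hV, hUV, hpU, hpV, hKUV⟩ := exists_isOpen_covering_of_isTotallyDisconnected
      (hK n) (hKd n) isClosed_closure isClosed_closure p.2.2.2
    exact ⟨⟨(U, V), hU, hV, hUV⟩, subset_closure.trans hpU, subset_closure.trans hpV, hKUV⟩
  choose next hnext_left hnext_right hnext_covers using hstep
  obtain ⟨U₀, hxU₀, hU₀, V₀, hyV₀, hV₀, hUV₀⟩ := exists_open_nhds_disjoint_closure hxy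
  let p : ℕ → Separation := Nat.rec ⟨(U₀, V₀), hU₀, hV₀, hUV₀⟩ next
  have hleft : Monotone fun n => (p n).1.1 := monotone_nat_of_le_succ fun n => hnext_left n (p n)
  have hright : Monotone fun n => (p n).1.2 := monotone_nat_of_le_succ fun n => hnext_right n (p n)
  refine ⟨⋃ n, (p n).1.1, ⋃ n, (p n).1.2, isOpen_iUnion fun n => (p n).2.1,
    isOpen_iUnion fun n => (p n).2.2.1, mem_iUnion.2 ⟨0, hxU₀⟩, mem_iUnion.2 ⟨0, hyV₀⟩,
    iUnion_subset fun n => ?_, ?_⟩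
  · exact (hnext_covers n (p n)).trans (union_subset_union
      (subset_iUnion (fun n => (p n).1.1) (n + 1)) (subset_iUnion (fun n => (p n).1.2) (n + 1)))
  · simp only [disjoint_iUnion_left, disjoint_iUnion_right]
    exact fun m n => (p (max m n)).2.2.2.mono
      ((hleft (le_max_right m n)).trans subset_closure)
      ((hright (le_max_left m n)).trans subset_closure)

theorem isTotallySeparated_iUnion_of_isCompact [T4Space Y] {ι : Type*} [Countable ι]
    {K : ι → Set Y} (hK : ∀ i, IsCompact (K i)) (hKd : ∀ i, IsTotallyDisconnected (K i)) :
    IsTotallySeparated (⋃ i, K i) := by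
  rcases isEmpty_or_nonempty ι with _ | _
  · rw [iUnion_of_empty]
    exact isTotallySeparated_empty
  · obtain ⟨e, he⟩ := exists_surjective_nat ι
    rw [← he.iUnion_comp K]
    exact isTotallySeparated_iUnion_nat (fun n => hK (e n)) fun n => hKd (e n)

end TotallyDisconnected

section VanishingDirections

lemma abs_sub_lt_pi_of_isPreconnected_of_cos_pos {X : Type*} [TopologicalSpace X] {T : Set X}
    (hT : IsPreconnected T) {g : X → ℝ} (hg : ContinuousOn g T)
    (hcos : ∀ x ∈ T, 0 < Real.cos (g x)) {x y : X} (hx : x ∈ T) (hy : y ∈ T) :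
    |g x - g y| < Real.pi := by
  wlog hxy : g y ≤ g x generalizing x y
  · rw [abs_sub_comm]
    exact this hy hx (le_of_not_ge hxy)
  rw [abs_of_nonneg (sub_nonneg.2 hxy)]
  by_contra! hπ
  obtain ⟨z, hz, hgz⟩ := hT.intermediate_value hy hx hg
    (show g y + Real.pi ∈ Icc (g y) (g x) from ⟨by linarith [Real.pi_pos], by linarith⟩)
  have hcosz := hcos z hz
  rw [hgz, Real.cos_add_pi] at hcosz
  linarith [hcos y hy]

lemma tendsto_zero_of_tendsto_coe_angle {ι : Type*} {l : Filter ι} {θ : ι → ℝ}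
    (hθ : Tendsto (fun i => (θ i : Real.Angle)) l (𝓝 0)) (hπ : ∀ᶠ i in l, |θ i| < Real.pi) :
    Tendsto θ l (𝓝 0) := by
  rw [tendsto_zero_iff_norm_tendsto_zero] at hθ ⊢
  refine hθ.congr' ?_
  filter_upwards [hπ] with i hi
  refine (AddCircle.norm_coe_eq_abs_iff (2 * Real.pi) Real.two_pi_pos.ne').2 ?_
  rw [abs_of_pos Real.two_pi_pos]
  linarith

variable {ι V : Type*} [NormedAddCommGroup V] [InnerProductSpace ℝ V]

/-- The directions `w` along which the vectors `b i` tend to zero, that is, `⟨b i, w⟩ → 0`. -/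
def vanishingDirections (l : Filter ι) (b : ι → V) : Submodule ℝ V where
  carrier := {w | Tendsto (fun i => inner ℝ (b i) w) l (𝓝 0)}
  add_mem' {v w} hv hw := by simpa [inner_add_right] using Tendsto.add hv hw
  zero_mem' := by simpa using tendsto_const_nhds
  smul_mem' a w hw := by simpa [real_inner_smul_right] using Tendsto.const_mul a hw

/-- The vectors `w` for which `⟨b i, w⟩ → 0` modulo `2π`, that is, `exp (i ⟨b i, w⟩) → 1`. -/
def vanishingAngles (l : Filter ι) (b : ι → V) : AddSubgroup V where
  carrier := {w | Tendsto (fun i => ((inner ℝ (b i) w : ℝ) : Real.Angle)) l (𝓝 0)}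
  add_mem' {v w} hv hw := by simpa [inner_add_right] using Tendsto.add hv hw
  zero_mem' := by simpa using tendsto_const_nhds
  neg_mem' {w} hw := by simpa using Tendsto.neg hw

variable {l : Filter ι} {b : ι → V}

lemma mem_vanishingAngles_of_mem_vanishingDirections {w : V}
    (hw : w ∈ vanishingDirections l b) : w ∈ vanishingAngles l b :=
  (Real.Angle.continuous_coe.tendsto 0).comp hw

lemma eventually_half_le_cos_of_mem_vanishingAngles {w : V} (hw : w ∈ vanishingAngles l b) :
    ∀ᶠ i in l, 1 / 2 ≤ Real.cos (inner ℝ (b i) w) := by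
  have hcos := (Real.Angle.continuous_cos.tendsto 0).comp hw
  rw [Real.Angle.cos_zero] at hcos
  exact hcos.eventually_const_le one_half_lt_one

lemma tendsto_zero_of_vanishingDirections_eq_top [FiniteDimensional ℝ V]
    (h : vanishingDirections l b = ⊤) : Tendsto b l (𝓝 0) := by
  let e := stdOrthonormalBasis ℝ V
  have hcoord : ∀ j, Tendsto (fun i => inner ℝ (e j) (b i) • e j) l (𝓝 0) := fun j => by
    have hj : e j ∈ vanishingDirections l b := h ▸ Submodule.mem_top
    simpa only [zero_smul, real_inner_comm] using Tendsto.smul_const hj (e j)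
  simpa only [e.sum_repr', Finset.sum_const_zero] using
    tendsto_finsetSum Finset.univ fun j _ => hcoord j

lemma isTotallyDisconnected_setOf_half_le_cos {S : Set V} (hS : S ⊆ vanishingAngles l b)
    (hinj : ∀ x ∈ S, ∀ y ∈ S, x - y ∈ vanishingDirections l b → x = y) {s : Set ι} (hs : s ∈ l) :
    IsTotallyDisconnected (S ∩ {y | ∀ i ∈ s, 1 / 2 ≤ Real.cos (inner ℝ (b i) y)}) := by
  refine fun T hTS hT x hx y hy => hinj x (hTS hx).1 y (hTS hy).1 ?_
  refine tendsto_zero_of_tendsto_coe_angle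
    ((vanishingAngles l b).sub_mem (hS (hTS hx).1) (hS (hTS hy).1)) ?_
  filter_upwards [hs] with i hi
  rw [inner_sub_right]
  exact abs_sub_lt_pi_of_isPreconnected_of_cos_pos hT (g := fun y => inner ℝ (b i) y) (by fun_prop)
    (fun z hz => one_half_pos.trans_le ((hTS hz).2 i hi)) hx hy

lemma subsingleton_of_subset_vanishingAngles [l.IsCountablyGenerated] {S : Set V}
    (hSc : IsPreconnected S) (hSσ : IsSigmaCompact S) (hS : S ⊆ vanishingAngles l b)
    (hinj : ∀ x ∈ S, ∀ y ∈ S, x - y ∈ vanishingDirections l b → x = y) : S.Subsingleton := by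
  obtain ⟨K, hK, rfl⟩ := hSσ
  obtain ⟨s, hs⟩ := l.exists_antitone_basis
  let L : ℕ × ℕ → Set V := fun p =>
    K p.1 ∩ {y | ∀ i ∈ s p.2, 1 / 2 ≤ Real.cos (inner ℝ (b i) y)}
  have hLcompact : ∀ p, IsCompact (L p) := fun p => (hK p.1).inter_right <| by
    simp only [ofPred_forall]
    exact isClosed_iInter fun i => isClosed_iInter fun _ =>
      isClosed_le continuous_const (by fun_prop)
  have hLdisconn : ∀ p, IsTotallyDisconnected (L p) := fun p T hT =>
    isTotallyDisconnected_setOf_half_le_cos hS hinj (hs.mem p.2) T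
      (hT.trans (inter_subset_inter_left _ (subset_iUnion K p.1)))
  have hcover : ⋃ m, K m ⊆ ⋃ p, L p := fun y hy => by
    obtain ⟨m, hm⟩ := mem_iUnion.1 hy
    obtain ⟨n, hn⟩ :=
      hs.eventually_iff.1 (eventually_half_le_cos_of_mem_vanishingAngles (hS hy))
    exact mem_iUnion.2 ⟨(m, n), hm, fun i hi => hn.2 hi⟩
  exact (isTotallySeparated_iUnion_of_isCompact hLcompact hLdisconn).isTotallyDisconnected _
    hcover hSc

theorem sub_mem_vanishingDirections [FiniteDimensional ℝ V] [l.IsCountablyGenerated] {C : Set V}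
    (hCc : IsPreconnected C) (hCσ : IsSigmaCompact C)
    (hC : ∀ x ∈ C, ∀ y ∈ C, x - y ∈ vanishingAngles l b) {x y : V} (hx : x ∈ C) (hy : y ∈ C) :
    x - y ∈ vanishingDirections l b := by
  set W := vanishingDirections l b
  let f : V → V := fun z => Wᗮ.starProjection (z - y)
  have hf : Continuous f := by fun_prop
  have hfW : ∀ z, f z ∈ Wᗮ := fun z => Wᗮ.starProjection_apply_mem _
  have hf_mem : f '' C ⊆ vanishingAngles l b := by
    rintro _ ⟨z, hz, rfl⟩
    have hW := mem_vanishingAngles_of_mem_vanishingDirections (W.starProjection_apply_mem (z - y))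
    have hsub := (vanishingAngles l b).sub_mem (hC z hz y hy) hW
    rwa [← Submodule.starProjection_orthogonal_val] at hsub
  have hinj : ∀ u ∈ f '' C, ∀ v ∈ f '' C, u - v ∈ W → u = v := by
    rintro _ ⟨u, -, rfl⟩ _ ⟨v, -, rfl⟩ huv
    exact sub_eq_zero.1 (Submodule.disjoint_def.1 W.orthogonal_disjoint _ huv
      (Wᗮ.sub_mem (hfW u) (hfW v)))
  have hfxy : f x = f y := subsingleton_of_subset_vanishingAngles (hCc.image f hf.continuousOn)
    (hCσ.image hf) hf_mem hinj (mem_image_of_mem f hx) (mem_image_of_mem f hy)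
  have hfx : f x = 0 := by rw [hfxy]; simp [f]
  rwa [Submodule.starProjection_apply_eq_zero_iff, Submodule.orthogonal_orthogonal] at hfx

theorem tendsto_zero_of_sub_mem_vanishingAngles [FiniteDimensional ℝ V] [l.IsCountablyGenerated]
    {C : Set V} (hCc : IsPreconnected C) (hCσ : IsSigmaCompact C) (hspan : vectorSpan ℝ C = ⊤)
    (hC : ∀ x ∈ C, ∀ y ∈ C, x - y ∈ vanishingAngles l b) : Tendsto b l (𝓝 0) := by
  refine tendsto_zero_of_vanishingDirections_eq_top (top_le_iff.1 (hspan ▸ Submodule.span_le.2 ?_))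
  rintro _ ⟨x, hx, y, hy, rfl⟩
  exact sub_mem_vanishingDirections hCc hCσ hC hx hy

end VanishingDirections

section Exponents

lemma coe_arg_exp (z : ℂ) : ((Complex.arg (Complex.exp z) : ℝ) : Real.Angle) = z.im := by
  rw [Complex.arg_exp, ← Real.Angle.toReal_coe, Real.Angle.coe_toReal]

lemma tendsto_re_of_tendsto_exp {ι : Type*} {l : Filter ι} {z : ι → ℂ} {z₀ : ℂ}
    (h : Tendsto (fun i => Complex.exp (z i)) l (𝓝 (Complex.exp z₀))) :
    Tendsto (fun i => (z i).re) l (𝓝 z₀.re) := by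
  have hlog := h.norm.log (norm_ne_zero_iff.2 (Complex.exp_ne_zero z₀))
  simpa only [Complex.norm_exp, Real.log_exp] using hlog

lemma tendsto_coe_angle_im_of_tendsto_exp {ι : Type*} {l : Filter ι} {z : ι → ℂ} {z₀ : ℂ}
    (h : Tendsto (fun i => Complex.exp (z i)) l (𝓝 (Complex.exp z₀))) :
    Tendsto (fun i => ((z i).im : Real.Angle)) l (𝓝 (z₀.im : Real.Angle)) := by
  have harg := (Complex.continuousAt_arg_coe_angle (Complex.exp_ne_zero z₀)).tendsto.comp h
  simpa only [Function.comp_def, coe_arg_exp] using harg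

variable {V : Type*} [NormedAddCommGroup V] [InnerProductSpace ℝ V]

lemma re_pairing (u : Cplx V) (x : V) : (pairing u x).re = inner ℝ u.1 x := by simp [pairing]

lemma im_pairing (u : Cplx V) (x : V) : (pairing u x).im = inner ℝ u.2 x := by simp [pairing]

theorem tendsto_of_tendsto_exp_pairing [FiniteDimensional ℝ V] {ι : Type*} {l : Filter ι}
    [l.IsCountablyGenerated] {C : Set V} (hCc : IsPreconnected C) (hCσ : IsSigmaCompact C)
    (hspan : vectorSpan ℝ C = ⊤) {w : ι → Cplx V} {w₀ : Cplx V}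
    (h : ∀ x ∈ C, Tendsto (fun i => Complex.exp (pairing (w i) x)) l
      (𝓝 (Complex.exp (pairing w₀ x)))) :
    Tendsto w l (𝓝 w₀) := by
  have hre : ∀ x ∈ C, x ∈ vanishingAngles l fun i => (w i).1 - w₀.1 := fun x hx => by
    have hx_re := tendsto_re_of_tendsto_exp (h x hx)
    rw [← tendsto_sub_nhds_zero_iff] at hx_re
    simp only [re_pairing, ← inner_sub_left] at hx_re
    exact mem_vanishingAngles_of_mem_vanishingDirections hx_re
  have him : ∀ x ∈ C, x ∈ vanishingAngles l fun i => (w i).2 - w₀.2 := fun x hx => by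
    have hx_im := tendsto_coe_angle_im_of_tendsto_exp (h x hx)
    rw [← tendsto_sub_nhds_zero_iff] at hx_im
    simp only [im_pairing, ← Real.Angle.coe_sub, ← inner_sub_left] at hx_im
    exact hx_im
  have hfst := tendsto_zero_of_sub_mem_vanishingAngles hCc hCσ hspan fun x hx y hy =>
    sub_mem (hre x hx) (hre y hy)
  have hsnd := tendsto_zero_of_sub_mem_vanishingAngles hCc hCσ hspan fun x hx y hy =>
    sub_mem (him x hx) (him y hy)
  exact (tendsto_sub_nhds_zero_iff.1 hfst).prodMk_nhds (tendsto_sub_nhds_zero_iff.1 hsnd)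

end Exponents

section WeakConvergence

lemma continuous_integral_of_continuous_uncurry {X Y 𝕜 : Type*} [TopologicalSpace X]
    [SecondCountableTopology X] [PseudoMetrizableSpace X] [MeasurableSpace X]
    [OpensMeasurableSpace X] [TopologicalSpace Y] [SecondCountableTopology Y]
    [PseudoMetrizableSpace Y] [RCLike 𝕜] {F : X → Y → 𝕜} (hF : Continuous (Function.uncurry F))
    {C : ℝ} (hFC : ∀ x y, ‖F x y‖ ≤ C) :
    Continuous fun p : ProbabilityMeasure X × Y => ∫ x, F x p.2 ∂(p.1 : Measure X) := by
  borelize Y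
  have hprod : Continuous fun p : ProbabilityMeasure X × Y => p.1.prod (diracProba p.2) :=
    ProbabilityMeasure.continuous_prod.comp
      (continuous_fst.prodMk (continuous_diracProba.comp continuous_snd))
  have hint : ∀ p : ProbabilityMeasure X × Y, ∫ z, Function.uncurry F z
      ∂(p.1.prod (diracProba p.2) : Measure (X × Y)) = ∫ x, F x p.2 ∂(p.1 : Measure X) :=
    fun p => by
      have hdirac : (diracProba p.2 : Measure Y) = Measure.dirac p.2 := rfl
      rw [ProbabilityMeasure.toMeasure_prod, hdirac, Measure.prod_dirac,
        integral_map measurable_prodMk_right.aemeasurable hF.aestronglyMeasurable]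
      rfl
  simp only [← hint]
  exact continuous_iff_continuousAt.2 fun p =>
    (ProbabilityMeasure.tendsto_iff_forall_integral_rclike_tendsto 𝕜).1 (hprod.tendsto p)
      (.ofNormedAddCommGroup (Function.uncurry F) hF C fun z => hFC z.1 z.2)

lemma tendsto_of_tendsto_map_of_isInducing {X Y ι : Type*} [TopologicalSpace X]
    [MeasurableSpace X] [OpensMeasurableSpace X] [TopologicalSpace Y] [HasOuterApproxClosed Y]
    [MeasurableSpace Y] [BorelSpace Y] {j : X → Y} (hj : IsInducing j) {l : Filter ι}
    [l.IsCountablyGenerated] {μ : ι → ProbabilityMeasure X} {μ₀ : ProbabilityMeasure X}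
    (h : Tendsto (fun i => (μ i).map hj.continuous.measurable.aemeasurable) l
      (𝓝 (μ₀.map hj.continuous.measurable.aemeasurable))) :
    Tendsto μ l (𝓝 μ₀) := by
  refine tendsto_of_forall_isOpen_le_liminf' fun G hG => ?_
  obtain ⟨H, hH, rfl⟩ := hj.isOpen_iff.1 hG
  have hliminf := ProbabilityMeasure.le_liminf_measure_open_of_tendsto h hH
  simpa only [ProbabilityMeasure.map_apply' _ _ hH.measurableSet] using hliminf

end WeakConvergence

section Cemetery

variable {V : Type*} [NormedAddCommGroup V]

/-- The embedding of `E ∪ {Δ}` into `V × ℝ` that sends `x ∈ E` to `(x, 0)` and `Δ` to `(0, 1)`; it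
makes tools for inner product spaces available on `E ∪ {Δ}`. -/
noncomputable def cemeteryEmbedding (E : Set V) : WithCemetery E → WithLp 2 (V × ℝ) :=
  Sum.elim (fun x => WithLp.toLp 2 ((x : V), 0)) fun _ => WithLp.toLp 2 (0, 1)

lemma isEmbedding_cemeteryEmbedding (E : Set V) : IsEmbedding (cemeteryEmbedding E) := by
  have hE : IsEmbedding fun x : E => WithLp.toLp 2 ((x : V), (0 : ℝ)) :=
    (WithLp.homeomorphProd 2 V ℝ).symm.isEmbedding.comp
      ((isEmbedding_prodMkLeft (0 : ℝ)).comp IsEmbedding.subtypeVal)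
  have hdisj : Disjoint {z : WithLp 2 (V × ℝ) | z.snd = 0} {WithLp.toLp 2 (0, 1)} := by simp
  have hclosed : IsClosed {z : WithLp 2 (V × ℝ) | z.snd = 0} :=
    isClosed_eq (by fun_prop) continuous_const
  have hrange : range (fun x : E => WithLp.toLp 2 ((x : V), (0 : ℝ))) ⊆ {z | z.snd = 0} :=
    range_subset_iff.2 fun _ => rfl
  refine ⟨hE.isInducing.sumElim (.of_subsingleton _) ?_ ?_, hE.injective.sumElim
    (Function.injective_of_subsingleton _) fun x _ h => ?_⟩
  · rw [range_const]
    exact hdisj.mono_left (closure_minimal hrange hclosed)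
  · rw [range_const, closure_singleton]
    exact hdisj.mono_left hrange
  · simpa using congrArg WithLp.snd h

end Cemetery

section ExponentialFunctions

variable {V : Type*} [NormedAddCommGroup V] [InnerProductSpace ℝ V]

lemma continuous_uncurry_expFun (E : Set V) :
    Continuous (Function.uncurry fun (y : WithCemetery E) (u : Cplx V) => expFun E u y) := by
  rw [← Homeomorph.sumProdDistrib.symm.comp_continuous_iff', continuous_sum_dom]
  refine ⟨?_, continuous_const⟩
  change Continuous fun p : E × Cplx V => Complex.exp (pairing p.2 p.1)
  unfold pairing
  fun_prop

lemma continuous_expFun (E : Set V) (u : Cplx V) : Continuous (expFun E u) :=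
  (continuous_uncurry_expFun E).uncurry_right u

lemma norm_expFun_le {E : Set V} {u : Cplx V} {k : ℕ} (hu : u ∈ boundedExponentsBy E k)
    (y : WithCemetery E) : ‖expFun E u y‖ ≤ k := by
  rcases y with x | _
  · exact hu x x.2
  · simp [expFun]

lemma mem_boundedExponents {E : Set V} {u : Cplx V} {k : ℕ} (hu : u ∈ boundedExponentsBy E k) :
    u ∈ boundedExponents E :=
  ⟨k, hu⟩

lemma zero_prod_mem_boundedExponentsBy (E : Set V) (v : V) : (0, v) ∈ boundedExponentsBy E 1 :=
  fun x _ => by simp [Complex.norm_exp, re_pairing]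

variable [MeasurableSpace V] [BorelSpace V] {E : Set V}

lemma integrable_expFun_zero_prod (μ : ProbabilityMeasure (WithCemetery E)) (v : V) :
    Integrable (expFun E (0, v)) (μ : Measure (WithCemetery E)) :=
  .of_bound (continuous_expFun E _).aestronglyMeasurable _
    (ae_of_all _ (norm_expFun_le (zero_prod_mem_boundedExponentsBy E v)))

variable [FiniteDimensional ℝ V]

lemma charFun_map_cemeteryEmbedding (μ : ProbabilityMeasure (WithCemetery E))
    (t : WithLp 2 (V × ℝ)) :
    charFun ((μ : Measure (WithCemetery E)).map (cemeteryEmbedding E)) t =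
      ∫ y, expFun E (0, t.fst) y ∂(μ : Measure (WithCemetery E)) +
        Complex.exp (t.snd * Complex.I) *
          (1 - ∫ y, expFun E (0, 0) y ∂(μ : Measure (WithCemetery E))) := by
  have hpointwise : ∀ y, Complex.exp (inner ℝ (cemeteryEmbedding E y) t * Complex.I) =
      expFun E (0, t.fst) y + Complex.exp (t.snd * Complex.I) * (1 - expFun E (0, 0) y) := by
    rintro (x | _)
    · simp [cemeteryEmbedding, expFun, pairing, real_inner_comm, mul_comm]
    · simp [cemeteryEmbedding, expFun]
  have hint := integrable_expFun_zero_prod μ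
  have hint_compl : Integrable (fun y => Complex.exp (t.snd * Complex.I) * (1 - expFun E (0, 0) y))
      (μ : Measure (WithCemetery E)) := ((integrable_const 1).sub (hint 0)).const_mul _
  rw [charFun_apply, integral_map
    (isEmbedding_cemeteryEmbedding E).continuous.measurable.aemeasurable (by fun_prop)]
  simp only [hpointwise]
  rw [integral_add (hint _) hint_compl, integral_const_mul,
    integral_sub (integrable_const 1) (hint 0), integral_const, probReal_univ, one_smul]

lemma tendsto_of_tendsto_integral_expFun {ι : Type*} {l : Filter ι} [l.IsCountablyGenerated]
    {μ : ι → ProbabilityMeasure (WithCemetery E)} {μ₀ : ProbabilityMeasure (WithCemetery E)}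
    (h : ∀ v : V, Tendsto (fun i => ∫ y, expFun E (0, v) y ∂(μ i : Measure (WithCemetery E))) l
      (𝓝 (∫ y, expFun E (0, v) y ∂(μ₀ : Measure (WithCemetery E))))) :
    Tendsto μ l (𝓝 μ₀) := by
  refine tendsto_of_seq_tendsto fun n hn => tendsto_of_tendsto_map_of_isInducing
    (isEmbedding_cemeteryEmbedding E).isInducing
    (ProbabilityMeasure.tendsto_of_tendsto_charFun fun t => ?_)
  simp only [Function.comp_apply, ProbabilityMeasure.toMeasure_map, charFun_map_cemeteryEmbedding]
  exact ((h _).comp hn).add ((((h 0).comp hn).const_sub 1).const_mul _)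

end ExponentialFunctions

section TransitionFunctions

variable {V : Type*} [NormedAddCommGroup V] [InnerProductSpace ℝ V] [MeasurableSpace V]
  {E : Set V} {P : TransitionFunction E}

lemma TransitionFunction.expInt_self [BorelSpace V] (P : TransitionFunction E) (s : ℝ≥0)
    (u : Cplx V) (x : E) :
    P.expInt s s u x = Complex.exp (pairing u x) := by
  rw [TransitionFunction.expInt, P.diag,
    integral_dirac' _ _ (continuous_expFun E u).stronglyMeasurable]
  rfl

lemma TransitionFunction.IsAffineWith.eq_expInt_zero {Φ : ℝ≥0 → ℝ≥0 → Cplx V → ℂ}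
    {ψ : ℝ≥0 → ℝ≥0 → Cplx V → Cplx V} (haff : P.IsAffineWith Φ ψ) (h0 : (0 : V) ∈ E) {s t : ℝ≥0}
    (hst : s ≤ t) {u : Cplx V} (hu : u ∈ boundedExponents E) :
    Φ s t u = P.expInt s t u ⟨0, h0⟩ := by
  simp [haff s t hst u hu, pairing]

lemma TransitionFunction.IsAffineWith.continuousOn_Φ {Φ : ℝ≥0 → ℝ≥0 → Cplx V → ℂ}
    {ψ : ℝ≥0 → ℝ≥0 → Cplx V → Cplx V} (haff : P.IsAffineWith Φ ψ) (h0 : (0 : V) ∈ E) {k : ℕ}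
    (hexp : ContinuousOn (fun q : ℝ≥0 × ℝ≥0 × Cplx V => P.expInt q.1 q.2.1 q.2.2 ⟨0, h0⟩)
      (timeExponents E k)) :
    ContinuousOn (fun q : ℝ≥0 × ℝ≥0 × Cplx V => Φ q.1 q.2.1 q.2.2) (timeExponents E k) :=
  hexp.congr fun _ hq => haff.eq_expInt_zero h0 hq.1 (mem_boundedExponents hq.2)

variable [FiniteDimensional ℝ V] {C : Set V}

lemma TransitionFunction.IsAffineWith.continuousOn_ψ {Φ : ℝ≥0 → ℝ≥0 → Cplx V → ℂ}
    {ψ : ℝ≥0 → ℝ≥0 → Cplx V → Cplx V} (haff : P.IsAffineWith Φ ψ) (hCE : C ⊆ E)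
    (hCc : IsPreconnected C) (hCσ : IsSigmaCompact C) (hspan : vectorSpan ℝ C = ⊤) {k : ℕ}
    (hΦ : ContinuousOn (fun q : ℝ≥0 × ℝ≥0 × Cplx V => Φ q.1 q.2.1 q.2.2) (timeExponents E k))
    (hexp : ∀ x : E, ContinuousOn (fun q : ℝ≥0 × ℝ≥0 × Cplx V => P.expInt q.1 q.2.1 q.2.2 x)
      (timeExponents E k)) :
    ContinuousOn (fun q : ℝ≥0 × ℝ≥0 × Cplx V => ψ q.1 q.2.1 q.2.2)
      (nonvanishingDomain E Φ k) := by
  have hdom : nonvanishingDomain E Φ k ⊆ timeExponents E k := fun _ hq => hq.1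
  have hne : ∀ q ∈ nonvanishingDomain E Φ k, Φ q.1 q.2.1 q.2.2 ≠ 0 :=
    fun q hq => hq.2 q.1 le_rfl hq.1.1
  have hquot : ∀ x : E, ContinuousOn
      (fun q : ℝ≥0 × ℝ≥0 × Cplx V => Complex.exp (pairing (ψ q.1 q.2.1 q.2.2) x))
      (nonvanishingDomain E Φ k) := fun x =>
    (((hexp x).mono hdom).div (hΦ.mono hdom) hne).congr fun q hq => by
      rw [Pi.div_apply, haff _ _ hq.1.1 _ (mem_boundedExponents hq.1.2),
        mul_div_cancel_left₀ _ (hne q hq)]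
  exact fun q hq => tendsto_of_tendsto_exp_pairing hCc hCσ hspan fun x hx => hquot ⟨x, hCE hx⟩ q hq

variable [BorelSpace V]

lemma TransitionFunction.IsAffineWith.ψ_self {Φ : ℝ≥0 → ℝ≥0 → Cplx V → ℂ}
    {ψ : ℝ≥0 → ℝ≥0 → Cplx V → Cplx V} (haff : P.IsAffineWith Φ ψ) (h0 : (0 : V) ∈ E) (hCE : C ⊆ E)
    (hCc : IsPreconnected C) (hCσ : IsSigmaCompact C) (hspan : vectorSpan ℝ C = ⊤) (s : ℝ≥0)
    {u : Cplx V} (hu : u ∈ boundedExponents E) : ψ s s u = u := by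
  have hΦ : Φ s s u = 1 := by simp [haff.eq_expInt_zero h0 le_rfl hu, P.expInt_self, pairing]
  have hexp : ∀ x ∈ C, Complex.exp (pairing (ψ s s u) x) = Complex.exp (pairing u x) :=
    fun x hx => by simpa [hΦ, P.expInt_self] using (haff s s le_rfl u hu ⟨x, hCE hx⟩).symm
  refine tendsto_const_nhds_iff (l := (atTop : Filter ℕ)).1
    (tendsto_of_tendsto_exp_pairing hCc hCσ hspan fun x hx => ?_)
  exact hexp x hx ▸ tendsto_const_nhds

lemma TransitionFunction.StochasticallyContinuous.continuousOn_expInt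
    (hP : P.StochasticallyContinuous) (x : E) (k : ℕ) :
    ContinuousOn (fun q : ℝ≥0 × ℝ≥0 × Cplx V => P.expInt q.1 q.2.1 q.2.2 x)
      (timeExponents E k) := by
  have : MetrizableSpace (WithCemetery E) := (isEmbedding_cemeteryEmbedding E).metrizableSpace
  have hint := continuous_integral_of_continuous_uncurry
    (F := fun (y : WithCemetery E) (u : boundedExponentsBy E k) => expFun E u y)
    ((continuous_uncurry_expFun E).comp (continuous_id.prodMap continuous_subtype_val))
    fun y u => norm_expFun_le u.2 y
  have hlaw : Continuous fun q : timeExponents E k =>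
      (P.law (Sum.inl x) ⟨(q.1.1, q.1.2.1), q.2.1⟩,
        (⟨q.1.2.2, q.2.2⟩ : boundedExponentsBy E k)) :=
    ((hP (Sum.inl x)).comp (by fun_prop)).prodMk (by fun_prop)
  exact continuousOn_iff_continuous_domRestrict.2 (hint.comp hlaw)

lemma TransitionFunction.stochasticallyContinuous_of_continuousOn_expInt
    (h : ∀ x : E, ContinuousOn (fun q : ℝ≥0 × ℝ≥0 × Cplx V => P.expInt q.1 q.2.1 q.2.2 x)
      (timeExponents E 1)) :
    P.StochasticallyContinuous := by
  rintro (x | _)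
  · refine continuous_iff_continuousAt.2 fun p => tendsto_of_tendsto_integral_expFun fun v => ?_
    have hcomp : Continuous fun p : TimePair => P.expInt p.1.1 p.1.2 (0, v) x :=
      (h x).comp_continuous (f := fun p : TimePair => (p.1.1, p.1.2, ((0, v) : Cplx V)))
        (by fun_prop) fun p => ⟨p.2, zero_prod_mem_boundedExponentsBy E v⟩
    exact hcomp.tendsto p
  · exact continuous_of_const fun p q =>
      Subtype.ext ((P.absorbing _ _ p.2).trans (P.absorbing _ _ q.2).symm)

end TransitionFunctions

section Spanning

lemma vectorSpan_eq_top_of_affineBasis {k V A ι : Type*} [Ring k] [AddCommGroup V] [Module k V]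
    [AddTorsor V A] (b : AffineBasis ι k A) {C : Set A} (hb : ∀ i, b i ∈ C) :
    vectorSpan k C = ⊤ := by
  have hspan : affineSpan k C = ⊤ :=
    top_le_iff.1 (b.tot ▸ affineSpan_mono k (range_subset_iff.2 hb))
  rw [← direction_affineSpan, hspan, AffineSubspace.direction_top]

lemma isClosed_connectedComponentIn {X : Type*} [TopologicalSpace X] {F : Set X} (hF : IsClosed F)
    (x : X) : IsClosed (connectedComponentIn F x) := by
  by_cases hx : x ∈ F
  · rw [connectedComponentIn_eq_image hx]
    exact hF.isClosedEmbedding_subtypeVal.isClosedMap _ isClosed_connectedComponent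
  · rw [connectedComponentIn_eq_empty hx]
    exact isClosed_empty

end Spanning

end AffineProcess

theorem mainTheorem8_general {V : Type*} [NormedAddCommGroup V] [InnerProductSpace ℝ V]
    [FiniteDimensional ℝ V] [MeasurableSpace V] [BorelSpace V] {E C : Set V} (h0 : (0 : V) ∈ E)
    (hCE : C ⊆ E) (hCc : IsPreconnected C) (hCσ : IsSigmaCompact C) (hspan : vectorSpan ℝ C = ⊤)
    (P : AffineProcess.TransitionFunction E)
    (Φ : ℝ≥0 → ℝ≥0 → AffineProcess.Cplx V → ℂ)
    (ψ : ℝ≥0 → ℝ≥0 → AffineProcess.Cplx V → AffineProcess.Cplx V)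
    (haff : P.IsAffineWith Φ ψ) :
    P.StochasticallyContinuous ↔
      ((∀ k : ℕ, ContinuousOn (fun q : ℝ≥0 × ℝ≥0 × AffineProcess.Cplx V => ψ q.1 q.2.1 q.2.2)
          (AffineProcess.nonvanishingDomain E Φ k)) ∧
        ψ 0 0 0 = 0 ∧
        (∀ k : ℕ, ContinuousOn (fun q : ℝ≥0 × ℝ≥0 × AffineProcess.Cplx V => Φ q.1 q.2.1 q.2.2)
          (AffineProcess.timeExponents E k)) ∧
        (∀ (x : E) (k : ℕ), ContinuousOn
          (fun q : ℝ≥0 × ℝ≥0 × AffineProcess.Cplx V => P.expInt q.1 q.2.1 q.2.2 x)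
          (AffineProcess.timeExponents E k))) := by
  refine ⟨fun hP => ?_, fun ⟨_, _, _, hexp⟩ =>
    AffineProcess.TransitionFunction.stochasticallyContinuous_of_continuousOn_expInt
      fun x => hexp x 1⟩
  have hexp := hP.continuousOn_expInt
  have hΦ := fun k => haff.continuousOn_Φ h0 (hexp ⟨0, h0⟩ k)
  have hψ := fun k => haff.continuousOn_ψ hCE hCc hCσ hspan (hΦ k) fun x => hexp x k
  have hzero : (0 : AffineProcess.Cplx V) ∈ AffineProcess.boundedExponents E :=
    AffineProcess.mem_boundedExponents (AffineProcess.zero_prod_mem_boundedExponentsBy E 0)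
  exact ⟨hψ, haff.ψ_self h0 hCE hCc hCσ hspan 0 hzero, hΦ, hexp⟩

theorem mainTheorem8 {V : Type*} [NormedAddCommGroup V] [InnerProductSpace ℝ V]
    [FiniteDimensional ℝ V] [MeasurableSpace V] [BorelSpace V]
    (E : Set V) (hE : IsClosed E) (h0 : (0 : V) ∈ E)
    (hcomp : ∃ x ∈ E, ∃ b : AffineBasis (Fin (Module.finrank ℝ V + 1)) ℝ V,
      ∀ i, b i ∈ connectedComponentIn E x)
    (P : AffineProcess.TransitionFunction E)
    (Φ : ℝ≥0 → ℝ≥0 → AffineProcess.Cplx V → ℂ)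
    (ψ : ℝ≥0 → ℝ≥0 → AffineProcess.Cplx V → AffineProcess.Cplx V)
    (haff : P.IsAffineWith Φ ψ) :
    P.StochasticallyContinuous ↔
      ((∀ k : ℕ, ContinuousOn (fun q : ℝ≥0 × ℝ≥0 × AffineProcess.Cplx V => ψ q.1 q.2.1 q.2.2)
          (AffineProcess.nonvanishingDomain E Φ k)) ∧
        ψ 0 0 0 = 0 ∧
        (∀ k : ℕ, ContinuousOn (fun q : ℝ≥0 × ℝ≥0 × AffineProcess.Cplx V => Φ q.1 q.2.1 q.2.2)
          (AffineProcess.timeExponents E k)) ∧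
        (∀ (x : E) (k : ℕ), ContinuousOn
          (fun q : ℝ≥0 × ℝ≥0 × AffineProcess.Cplx V => P.expInt q.1 q.2.1 q.2.2 x)
          (AffineProcess.timeExponents E k))) := by
  obtain ⟨x, -, b, hb⟩ := hcomp
  exact mainTheorem8_general h0 (connectedComponentIn_subset E x)
    isPreconnected_connectedComponentIn
    (isSigmaCompact_univ.of_isClosed_subset
      (AffineProcess.isClosed_connectedComponentIn hE x) (subset_univ _))
    (AffineProcess.vectorSpan_eq_top_of_affineBasis b hb) P Φ ψ haff
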